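/- Let $\sigma$ be a signature consisting of relation symbols only, let $C_1, C_2$ be sets of constant symbols with $C_1\cap C_2$ finite, and put $\sigma_1=\sigma\cup C_1$, $\sigma_2=\sigma\cup C_2$, $\sigma_3=\sigma\cup C_1\cup C_2$. For a $\sigma_1$-structure $A$ and a $\sigma_2$-structure $B$, the parallel sum $A\oplus B$ is the following $\sigma_3$-structure. Its universe is the quotient of the disjoint union $A+B$ by the least equivalence relation that identifies $c^A$ with $c^B$ for every $c\in C_1\cap C_2$; let $\iota$ denote the quotient map. For $R\in\sigma$, $R^{A\oplus B}$ is the union of the images of $R^A$ and $R^B$ under $\iota$; and $c^{A\oplus B}=\iota(c^A)$ for $c\in C_1$, $c^{A\oplus B}=\iota(c^B)$ for $c\in C_2$. For $k\in\mathbb{N}$ and structures $M,N$ over the same signature, write $M\equiv_{\mathrm{FO}_k}N$ if $M$ and $N$ satisfy the same sentences of first-order logic with equality of quantifier rank at most $k$ in that signature. Let $A_1,B_1$ be $\sigma_1$-structures and $A_2,B_2$ be $\sigma_2$-structures. If $A_1\equiv_{\mathrm{FO}_k}B_1$ and $A_2\equiv_{\mathrm{FO}_k}B_2$, then $A_1\oplus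 A_2\equiv_{\mathrm{FO}_k}B_1\oplus B_2$. -/

import Mathlib

open scoped FirstOrder

universe u v w x y z t

/-- The quantifier rank of a first-order formula: the maximal depth of nesting of quantifiers
(existential quantifiers are `¬ ∀ ¬`, so they count in the same way). -/
def quantifierRank {L : FirstOrder.Language.{u, v}} {α : Type w} :
    {n : ℕ} → L.BoundedFormula α n → ℕ
  | _, .falsum => 0
  | _, .equal _ _ => 0
  | _, .rel _ _ => 0
  | _, .imp φ ψ => max (quantifierRank φ) (quantifierRank ψ)
  | _, .all φ => quantifierRank φ + 1

/-- `M` and `N` satisfy the same first-order sentences (with equality) of quantifier rank at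
most `k`. -/
def FOEquiv (L : FirstOrder.Language.{u, v}) (k : ℕ) (M : Type w) (N : Type x)
    [L.Structure M] [L.Structure N] : Prop :=
  ∀ φ : L.Sentence, quantifierRank φ ≤ k → (M ⊨ φ ↔ N ⊨ φ)

section ParallelSum

variable (L : FirstOrder.Language.{u, v}) {K : Type w} (C₁ C₂ : Set K)
  (A : Type y) (B : Type z) [L[[C₁]].Structure A] [L[[C₂]].Structure B]

/-- The interpretation of the constant symbol `c ∈ C` in an `L[[C]]`-structure. -/
def constVal {C : Set K} (M : Type y) [L[[C]].Structure M] (c : C) : M :=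
  (L.con c : L[[C]].Constants)

/-- The interpretation of the relation symbol `R` of `L` in an `L[[C]]`-structure. -/
def relVal {C : Set K} {M : Type y} [L[[C]].Structure M] {n : ℕ} (R : L.Relations n)
    (a : Fin n → M) : Prop :=
  FirstOrder.Language.Structure.RelMap ((L.lhomWithConstants C).onRelation R) a

/-- The pairs `(c^A, c^B)` for the constant symbols `c` that are shared by both signatures. -/
inductive SharedConst : A ⊕ B → A ⊕ B → Prop
  | glue (c : K) (h₁ : c ∈ C₁) (h₂ : c ∈ C₂) :
      SharedConst (Sum.inl (constVal L A ⟨c, h₁⟩)) (Sum.inr (constVal L B ⟨c, h₂⟩))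

/-- The universe of the parallel sum: the quotient of the disjoint union by the least equivalence
relation that identifies `c^A` with `c^B` for every shared constant symbol `c`. -/
def ParallelSum : Type (max y z) :=
  Quot (SharedConst L C₁ C₂ A B)

namespace ParallelSum

variable {A B}

/-- The quotient map on the left summand. -/
def inl (a : A) : ParallelSum L C₁ C₂ A B := Quot.mk _ (Sum.inl a)

/-- The quotient map on the right summand. -/
def inr (b : B) : ParallelSum L C₁ C₂ A B := Quot.mk _ (Sum.inr b)

variable (A B)

open Classical in
/-- The interpretation of constants: `c` is the class of `c^A` if `c ∈ C₁`, and the class of `c^B`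
if `c ∈ C₂`; the two agree on shared constants, see `const_left` and `const_right`. -/
noncomputable def const (c : ↥(C₁ ∪ C₂)) : ParallelSum L C₁ C₂ A B :=
  if h : c.1 ∈ C₁ then inl L C₁ C₂ (constVal L A ⟨c.1, h⟩)
  else inr L C₁ C₂ (constVal L B ⟨c.1, c.2.resolve_left h⟩)

theorem const_left (c : K) (h : c ∈ C₁) :
    const L C₁ C₂ A B ⟨c, Or.inl h⟩ = inl L C₁ C₂ (constVal L A ⟨c, h⟩) := by
  simp [const, h]

theorem const_right (c : K) (h : c ∈ C₂) :
    const L C₁ C₂ A B ⟨c, Or.inr h⟩ = inr L C₁ C₂ (constVal L B ⟨c, h⟩) := by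
  by_cases h₁ : c ∈ C₁
  · simp only [const, h₁, dif_pos]
    exact Quot.sound (SharedConst.glue c h₁ h)
  · simp [const, h₁]

/-- The relations of the parallel sum: the images of the relations of the two summands. -/
noncomputable instance relStructure [L.IsRelational] : L.Structure (ParallelSum L C₁ C₂ A B) where
  funMap f := isEmptyElim f
  RelMap {n} R s :=
    (∃ a : Fin n → A, relVal L (C := C₁) R a ∧
      s = fun i => inl L C₁ C₂ (a i)) ∨
    (∃ b : Fin n → B, relVal L (C := C₂) R b ∧
      s = fun i => inr L C₁ C₂ (b i))

/-- The parallel sum as a structure over the signature with constants `C₁ ∪ C₂`. -/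
noncomputable instance sumStructure [L.IsRelational] :
    L[[↥(C₁ ∪ C₂)]].Structure (ParallelSum L C₁ C₂ A B) :=
  letI : (FirstOrder.Language.constantsOn ↥(C₁ ∪ C₂)).Structure (ParallelSum L C₁ C₂ A B) :=
    FirstOrder.Language.constantsOn.structure (const L C₁ C₂ A B)
  inferInstanceAs ((L.sum (FirstOrder.Language.constantsOn ↥(C₁ ∪ C₂))).Structure
    (ParallelSum L C₁ C₂ A B))

end ParallelSum

end ParallelSum

open FirstOrder.Language

/-! The argument is a Feferman–Vaught decomposition. Once each variable is assigned to one of the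
two summands, a formula φ about `A ⊕ B` becomes a finite disjunction of conjunctions α ∧ β, with α
about `A` and β about `B`, both of rank at most that of φ (`rankLE_separate`, `realize_separate`).
Such a disjunction has the same truth value in two pairs of structures that are componentwise
equivalent up to rank k.

A quantifier over the sum ranges over images of elements of `A` or of `B`, so it splits into one
quantifier on each side, and the rank of each component rises by at most one. Atomic formulas must
be translated without quantifiers. Two points of the disjoint union are glued only if they are equal
or are values of shared constants that get identified (`mk_eq_iff`). Hence a point has only finitely
many candidate preimages, all named by terms: itself and the shared constants. This is where
finiteness of `C₁ ∩ C₂` enters.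

The translation depends on the set `E` of identified pairs of shared constants. Equalities between
constants have rank 0, so both sums have the same `E` (`sharedConst_eq_of_imp`), and one translation
serves both. -/

theorem quantifierRank_not {L : FirstOrder.Language.{u, v}} {α : Type w} {n : ℕ}
    (φ : L.BoundedFormula α n) : quantifierRank φ.not = quantifierRank φ := by
  simp [quantifierRank]

theorem quantifierRank_top {L : FirstOrder.Language.{u, v}} {α : Type w} {n : ℕ} :
    quantifierRank (⊤ : L.BoundedFormula α n) = 0 := by
  change quantifierRank (BoundedFormula.falsum.imp BoundedFormula.falsum) = 0
  simp [quantifierRank]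

theorem quantifierRank_inf {L : FirstOrder.Language.{u, v}} {α : Type w} {n : ℕ}
    (φ ψ : L.BoundedFormula α n) :
    quantifierRank (φ ⊓ ψ) = max (quantifierRank φ) (quantifierRank ψ) := by
  change quantifierRank (φ.imp ψ.not).not = _
  simp [quantifierRank]

theorem quantifierRank_ex {L : FirstOrder.Language.{u, v}} {α : Type w} {n : ℕ}
    (φ : L.BoundedFormula α (n + 1)) : quantifierRank φ.ex = quantifierRank φ + 1 := by
  simp [quantifierRank]

/-! ### Separated formulas: Boolean operations, quantifiers and rank. -/

/-- A finite disjunction of conjunctions `α(x) ∧ β(y)`, where `α` is an `L₁`-formula about a first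
structure and `β` is an `L₂`-formula about a second structure. -/
def SeparatedFormula (L₁ : FirstOrder.Language.{u, v}) (L₂ : FirstOrder.Language.{w, x})
    (p q : ℕ) :=
  List (L₁.BoundedFormula Empty p × L₂.BoundedFormula Empty q)

namespace SeparatedFormula

variable {L₁ : FirstOrder.Language.{u, v}} {L₂ : FirstOrder.Language.{w, x}} {p q : ℕ}

/-- Satisfaction of a separated formula in a pair of structures. -/
def Realize {A : Type y} {B : Type z} [L₁.Structure A] [L₂.Structure B]
    (ψ : SeparatedFormula L₁ L₂ p q) (a : Fin p → A) (b : Fin q → B) : Prop :=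
  ∃ x ∈ (show List _ from ψ), x.1.Realize default a ∧ x.2.Realize default b

/-- All constituents have quantifier rank at most `k`. -/
def RankLE (k : ℕ) (ψ : SeparatedFormula L₁ L₂ p q) : Prop :=
  ∀ x ∈ (show List _ from ψ), quantifierRank x.1 ≤ k ∧ quantifierRank x.2 ≤ k

/-- The separated formula `α(x) ∧ β(y)`. -/
def both (α : L₁.BoundedFormula Empty p) (β : L₂.BoundedFormula Empty q) :
    SeparatedFormula L₁ L₂ p q :=
  [(α, β)]

/-- Disjunction of separated formulas. -/
def or (ψ χ : SeparatedFormula L₁ L₂ p q) : SeparatedFormula L₁ L₂ p q :=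
  List.append ψ χ

/-- Disjunction of a finite family of separated formulas. -/
noncomputable def iSup {ι : Type t} (s : Finset ι) (ψ : ι → SeparatedFormula L₁ L₂ p q) :
    SeparatedFormula L₁ L₂ p q :=
  s.toList.flatMap ψ

/-- Conjunction of separated formulas. -/
def and (ψ χ : SeparatedFormula L₁ L₂ p q) : SeparatedFormula L₁ L₂ p q :=
  List.flatMap (fun x => List.map (fun y => (x.1 ⊓ y.1, x.2 ⊓ y.2)) χ) ψ

/-- Negation of a separated formula. -/
def not (ψ : SeparatedFormula L₁ L₂ p q) : SeparatedFormula L₁ L₂ p q :=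
  List.foldr (fun x χ => and (or (both x.1.not ⊤) (both ⊤ x.2.not)) χ) (both ⊤ ⊤) ψ

/-- Existential quantification over the first structure. -/
def exLeft (ψ : SeparatedFormula L₁ L₂ (p + 1) q) : SeparatedFormula L₁ L₂ p q :=
  List.map (fun x => (x.1.ex, x.2)) ψ

/-- Existential quantification over the second structure. -/
def exRight (ψ : SeparatedFormula L₁ L₂ p (q + 1)) : SeparatedFormula L₁ L₂ p q :=
  List.map (fun x => (x.1, x.2.ex)) ψ

section Realize

variable {A : Type y} {B : Type z} [L₁.Structure A] [L₂.Structure B]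
  {a : Fin p → A} {b : Fin q → B}

theorem realize_both {α : L₁.BoundedFormula Empty p} {β : L₂.BoundedFormula Empty q} :
    (both α β).Realize a b ↔ α.Realize default a ∧ β.Realize default b := by
  simp [both, Realize]

theorem realize_or {ψ χ : SeparatedFormula L₁ L₂ p q} :
    (ψ.or χ).Realize a b ↔ ψ.Realize a b ∨ χ.Realize a b := by
  unfold Realize or
  constructor
  · rintro ⟨x, hx, h⟩
    exact (List.mem_append.1 hx).imp (fun hx => ⟨x, hx, h⟩) fun hx => ⟨x, hx, h⟩
  · rintro (⟨x, hx, h⟩ | ⟨x, hx, h⟩)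
    · exact ⟨x, List.mem_append.2 (Or.inl hx), h⟩
    · exact ⟨x, List.mem_append.2 (Or.inr hx), h⟩

theorem realize_iSup {ι : Type t} {s : Finset ι} {ψ : ι → SeparatedFormula L₁ L₂ p q} :
    (iSup s ψ).Realize a b ↔ ∃ i ∈ s, (ψ i).Realize a b := by
  unfold Realize iSup
  constructor
  · rintro ⟨x, hx, h⟩
    obtain ⟨i, hi, hx⟩ := List.mem_flatMap.1 hx
    exact ⟨i, Finset.mem_toList.1 hi, x, hx, h⟩
  · rintro ⟨i, hi, x, hx, h⟩
    exact ⟨x, List.mem_flatMap.2 ⟨i, Finset.mem_toList.2 hi, hx⟩, h⟩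

theorem realize_and {ψ χ : SeparatedFormula L₁ L₂ p q} :
    (ψ.and χ).Realize a b ↔ ψ.Realize a b ∧ χ.Realize a b := by
  unfold Realize and
  constructor
  · rintro ⟨x, hx, h⟩
    obtain ⟨y, hy, hx⟩ := List.mem_flatMap.1 hx
    obtain ⟨z, hz, rfl⟩ := List.mem_map.1 hx
    simp only [BoundedFormula.realize_inf] at h
    exact ⟨⟨y, hy, h.1.1, h.2.1⟩, ⟨z, hz, h.1.2, h.2.2⟩⟩
  · rintro ⟨⟨y, hy, h₁, h₂⟩, ⟨z, hz, h₃, h₄⟩⟩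
    refine ⟨_, List.mem_flatMap.2 ⟨y, hy, List.mem_map.2 ⟨z, hz, rfl⟩⟩, ?_⟩
    simp [*]

theorem realize_not {ψ : SeparatedFormula L₁ L₂ p q} :
    ψ.not.Realize a b ↔ ¬ψ.Realize a b := by
  induction ψ with
  | nil =>
    refine iff_of_true (realize_both.2 ⟨?_, ?_⟩) (by simp [Realize]) <;>
    exact BoundedFormula.realize_top.2 trivial
  | cons x ψ ih =>
    have : Realize (L₁ := L₁) (L₂ := L₂) (x :: ψ) a b ↔
        (x.1.Realize default a ∧ x.2.Realize default b) ∨ Realize ψ a b := by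
      simp [Realize]
    rw [this]
    change (and _ (not ψ)).Realize a b ↔ _
    simp only [realize_and, realize_or, realize_both, ih, BoundedFormula.realize_not,
      BoundedFormula.realize_top]
    tauto

/-- An existential quantifier commutes with the disjunction, and the conjunct about the second
structure does not involve the quantified variable. -/
theorem realize_exLeft {ψ : SeparatedFormula L₁ L₂ (p + 1) q} :
    ψ.exLeft.Realize a b ↔ ∃ x : A, ψ.Realize (Fin.snoc a x : Fin (p + 1) → A) b := by
  unfold Realize exLeft
  constructor
  · rintro ⟨x, hx, h⟩
    obtain ⟨y, hy, rfl⟩ := List.mem_map.1 hx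
    obtain ⟨c, hc⟩ := BoundedFormula.realize_ex.1 h.1
    exact ⟨c, y, hy, hc, h.2⟩
  · rintro ⟨c, y, hy, hc, h⟩
    exact ⟨_, List.mem_map.2 ⟨y, hy, rfl⟩, BoundedFormula.realize_ex.2 ⟨c, hc⟩, h⟩

theorem realize_exRight {ψ : SeparatedFormula L₁ L₂ p (q + 1)} :
    ψ.exRight.Realize a b ↔ ∃ y : B, ψ.Realize a (Fin.snoc b y : Fin (q + 1) → B) := by
  unfold Realize exRight
  constructor
  · rintro ⟨x, hx, h⟩
    obtain ⟨y, hy, rfl⟩ := List.mem_map.1 hx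
    obtain ⟨c, hc⟩ := BoundedFormula.realize_ex.1 h.2
    exact ⟨c, y, hy, h.1, hc⟩
  · rintro ⟨c, y, hy, h, hc⟩
    exact ⟨_, List.mem_map.2 ⟨y, hy, rfl⟩, h, BoundedFormula.realize_ex.2 ⟨c, hc⟩⟩

end Realize

section Rank

variable {k l : ℕ}

theorem RankLE.mono {ψ : SeparatedFormula L₁ L₂ p q} (h : ψ.RankLE k) (hkl : k ≤ l) :
    ψ.RankLE l :=
  fun x hx => ⟨(h x hx).1.trans hkl, (h x hx).2.trans hkl⟩

theorem rankLE_both {α : L₁.BoundedFormula Empty p} {β : L₂.BoundedFormula Empty q}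
    (hα : quantifierRank α ≤ k) (hβ : quantifierRank β ≤ k) : (both α β).RankLE k := by
  intro x hx
  obtain rfl := List.mem_singleton.1 hx
  exact ⟨hα, hβ⟩

theorem RankLE.or {ψ χ : SeparatedFormula L₁ L₂ p q} (hψ : ψ.RankLE k) (hχ : χ.RankLE k) :
    (ψ.or χ).RankLE k :=
  fun x hx => (List.mem_append.1 hx).elim (hψ x) (hχ x)

theorem rankLE_iSup {ι : Type t} {s : Finset ι} {ψ : ι → SeparatedFormula L₁ L₂ p q}
    (h : ∀ i ∈ s, (ψ i).RankLE k) : (iSup s ψ).RankLE k := by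
  intro x hx
  obtain ⟨i, hi, hx⟩ := List.mem_flatMap.1 hx
  exact h i (Finset.mem_toList.1 hi) x hx

theorem RankLE.and {ψ χ : SeparatedFormula L₁ L₂ p q} (hψ : ψ.RankLE k) (hχ : χ.RankLE k) :
    (ψ.and χ).RankLE k := by
  intro x hx
  obtain ⟨y, hy, hx⟩ := List.mem_flatMap.1 hx
  obtain ⟨z, hz, rfl⟩ := List.mem_map.1 hx
  simp only [quantifierRank_inf]
  exact ⟨max_le (hψ y hy).1 (hχ z hz).1, max_le (hψ y hy).2 (hχ z hz).2⟩

theorem rankLE_true : (both ⊤ ⊤ : SeparatedFormula L₁ L₂ p q).RankLE k :=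
  rankLE_both (by simp [quantifierRank_top]) (by simp [quantifierRank_top])

theorem RankLE.not {ψ : SeparatedFormula L₁ L₂ p q} (hψ : ψ.RankLE k) : ψ.not.RankLE k := by
  induction ψ with
  | nil => exact rankLE_true
  | cons x ψ ih =>
    have hx := hψ x List.mem_cons_self
    refine RankLE.and (RankLE.or (rankLE_both ?_ ?_) (rankLE_both ?_ ?_))
      (ih fun y hy => hψ y (List.mem_cons_of_mem x hy)) <;>
    simp [quantifierRank_not, quantifierRank_top, hx]

theorem RankLE.exLeft {ψ : SeparatedFormula L₁ L₂ (p + 1) q} (hψ : ψ.RankLE k) :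
    ψ.exLeft.RankLE (k + 1) := by
  intro x hx
  obtain ⟨y, hy, rfl⟩ := List.mem_map.1 hx
  have := hψ y hy
  simp only [quantifierRank_ex]
  omega

theorem RankLE.exRight {ψ : SeparatedFormula L₁ L₂ p (q + 1)} (hψ : ψ.RankLE k) :
    ψ.exRight.RankLE (k + 1) := by
  intro x hx
  obtain ⟨y, hy, rfl⟩ := List.mem_map.1 hx
  have := hψ y hy
  simp only [quantifierRank_ex]
  omega

end Rank

/-- Conjunction of a finite family of separated formulas. -/
noncomputable def iInf {ι : Type t} (s : Finset ι) (ψ : ι → SeparatedFormula L₁ L₂ p q) :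
    SeparatedFormula L₁ L₂ p q :=
  (iSup s fun i => (ψ i).not).not

theorem realize_iInf {A : Type y} {B : Type z} [L₁.Structure A] [L₂.Structure B]
    {a : Fin p → A} {b : Fin q → B} {ι : Type t} {s : Finset ι}
    {ψ : ι → SeparatedFormula L₁ L₂ p q} :
    (iInf s ψ).Realize a b ↔ ∀ i ∈ s, (ψ i).Realize a b := by
  simp [iInf, realize_not, realize_iSup]

theorem rankLE_iInf {k : ℕ} {ι : Type t} {s : Finset ι} {ψ : ι → SeparatedFormula L₁ L₂ p q}
    (h : ∀ i ∈ s, (ψ i).RankLE k) : (iInf s ψ).RankLE k :=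
  (rankLE_iSup fun i hi => (h i hi).not).not

end SeparatedFormula

namespace ParallelSum

variable {L : FirstOrder.Language.{u, v}} {K : Type w} {C₁ C₂ : Set K}

/-! ### Which points the quotient identifies. -/

section Gluing

variable {A : Type y} {B : Type z} [L[[C₁]].Structure A] [L[[C₂]].Structure B]

variable (L A) in
/-- The value in the left summand of a shared constant. -/
def leftConst (c : ↥(C₁ ∩ C₂)) : A := constVal L A (⟨c.1, c.2.1⟩ : C₁)

variable (L B) in
/-- The value in the right summand of a shared constant. -/
def rightConst (c : ↥(C₁ ∩ C₂)) : B := constVal L B (⟨c.1, c.2.2⟩ : C₂)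

variable (L A B) in
/-- The value in the parallel sum of a shared constant. -/
def sharedConst (c : ↥(C₁ ∩ C₂)) : ParallelSum L C₁ C₂ A B := inl L C₁ C₂ (leftConst L A c)

theorem inr_rightConst (c : ↥(C₁ ∩ C₂)) :
    inr L C₁ C₂ (rightConst L B c) = sharedConst L A B c :=
  (Quot.sound (SharedConst.glue c.1 c.2.1 c.2.2)).symm

variable (L A B) in
/-- `x` is the value of the shared constant `c` in the disjoint union. -/
def IsShared (c : ↥(C₁ ∩ C₂)) (x : A ⊕ B) : Prop :=
  x = Sum.inl (leftConst L A c) ∨ x = Sum.inr (rightConst L B c)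

theorem IsShared.mk_eq {c : ↥(C₁ ∩ C₂)} {x : A ⊕ B} (h : IsShared L A B c x) :
    (Quot.mk _ x : ParallelSum L C₁ C₂ A B) = sharedConst L A B c := by
  rcases h with rfl | rfl
  · rfl
  · exact inr_rightConst c

/-- Gluing identifies distinct elements only if both are shared constants, and which shared
constants are identified depends only on the equalities between them in each summand. -/
theorem eq_or_isShared_of_mk_eq {A' : Type x} {B' : Type t} [L[[C₁]].Structure A']
    [L[[C₂]].Structure B']
    (hA : ∀ c d : ↥(C₁ ∩ C₂), leftConst L A c = leftConst L A d →
      leftConst L A' c = leftConst L A' d)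
    (hB : ∀ c d : ↥(C₁ ∩ C₂), rightConst L B c = rightConst L B d →
      rightConst L B' c = rightConst L B' d) {x y : A ⊕ B}
    (h : (Quot.mk _ x : ParallelSum L C₁ C₂ A B) = Quot.mk _ y) :
    x = y ∨ ∃ c d : ↥(C₁ ∩ C₂), IsShared L A B c x ∧ IsShared L A B d y ∧
      sharedConst L A' B' c = sharedConst L A' B' d := by
  -- Needed for transitivity: the middle point may be named by two different shared constants, and
  -- this coincidence in one summand carries over to `A'` or `B'`.
  have key : ∀ {c d : ↥(C₁ ∩ C₂)} {x : A ⊕ B}, IsShared L A B c x → IsShared L A B d x →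
      sharedConst L A' B' c = sharedConst L A' B' d := by
    rintro c d x (rfl | rfl) (h | h)
    · exact congrArg (inl L C₁ C₂) (hA c d (Sum.inl.inj h))
    · cases h
    · cases h
    · rw [← inr_rightConst, ← inr_rightConst, hB c d (Sum.inr.inj h)]
  replace h := Quot.eqvGen_exact h
  induction h with
  | rel x y h =>
    obtain ⟨c, h₁, h₂⟩ := h
    exact Or.inr ⟨⟨c, h₁, h₂⟩, ⟨c, h₁, h₂⟩, Or.inl rfl, Or.inr rfl, rfl⟩
  | refl x => exact Or.inl rfl
  | symm x y h ih =>
    rcases ih with rfl | ⟨c, d, hc, hd, e⟩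
    · exact Or.inl rfl
    · exact Or.inr ⟨d, c, hd, hc, e.symm⟩
  | trans x y z h₁ h₂ ih₁ ih₂ =>
    rcases ih₁ with rfl | ⟨c, d, hc, hd, e⟩
    · exact ih₂
    · rcases ih₂ with rfl | ⟨c', d', hc', hd', e'⟩
      · exact Or.inr ⟨c, d, hc, hd, e⟩
      · exact Or.inr ⟨c, d', hc, hd', e.trans ((key hd hc').trans e')⟩

/-- Identifications of shared constants arise from chains of equalities inside the summands, and
each link is preserved on passing to `A'` and `B'`. -/
theorem sharedConst_eq_of_imp {A' : Type x} {B' : Type t} [L[[C₁]].Structure A']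
    [L[[C₂]].Structure B']
    (hA : ∀ c d : ↥(C₁ ∩ C₂), leftConst L A c = leftConst L A d →
      leftConst L A' c = leftConst L A' d)
    (hB : ∀ c d : ↥(C₁ ∩ C₂), rightConst L B c = rightConst L B d →
      rightConst L B' c = rightConst L B' d) {c d : ↥(C₁ ∩ C₂)}
    (h : sharedConst L A B c = sharedConst L A B d) :
    sharedConst L A' B' c = sharedConst L A' B' d := by
  have key : ∀ {c d : ↥(C₁ ∩ C₂)}, IsShared L A B d (Sum.inl (leftConst L A c)) →
      sharedConst L A' B' c = sharedConst L A' B' d := by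
    rintro c d (h | h)
    · exact congrArg (inl L C₁ C₂) (hA c d (Sum.inl.inj h))
    · cases h
  rcases eq_or_isShared_of_mk_eq hA hB h with h | ⟨c', d', hc, hd, e⟩
  · exact key (Or.inl h)
  · exact (key hc).trans (e.trans (key hd).symm)

/-- The case `A' = A`, `B' = B` of the lemma on glued points. The second alternative ranges over
constant symbols rather than elements, so it can be written without quantifiers. -/
theorem mk_eq_iff {x y : A ⊕ B} :
    (Quot.mk _ x : ParallelSum L C₁ C₂ A B) = Quot.mk _ y ↔
      x = y ∨ ∃ c d : ↥(C₁ ∩ C₂), IsShared L A B c x ∧ IsShared L A B d y ∧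
        sharedConst L A B c = sharedConst L A B d := by
  constructor
  · exact eq_or_isShared_of_mk_eq (fun _ _ => id) fun _ _ => id
  · rintro (rfl | ⟨c, d, hc, hd, e⟩)
    · rfl
    · rw [hc.mk_eq, hd.mk_eq, e]

end Gluing

/-! ### Translation of formulas about the sum into separated formulas. -/

section Translation

variable {p q n : ℕ}

/-- A term of one of the two summands. -/
abbrev SplitTerm (L : FirstOrder.Language.{u, v}) {K : Type w} (C₁ C₂ : Set K) (p q : ℕ) :=
  L[[C₁]].Term (Empty ⊕ Fin p) ⊕ L[[C₂]].Term (Empty ⊕ Fin q)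

/-- The value of a split term in the disjoint union. -/
def SplitTerm.realize {A : Type y} {B : Type z} [L[[C₁]].Structure A] [L[[C₂]].Structure B]
    (s : SplitTerm L C₁ C₂ p q) (a : Fin p → A) (b : Fin q → B) : A ⊕ B :=
  Sum.map (fun s => s.realize (Sum.elim default a)) (fun s => s.realize (Sum.elim default b)) s

open Classical in
/-- The split term of a constant symbol. -/
noncomputable def splitConst (c : ↥(C₁ ∪ C₂)) : SplitTerm L C₁ C₂ p q :=
  if h : c.1 ∈ C₁ then Sum.inl (L.con (⟨c.1, h⟩ : C₁)).term
  else Sum.inr (L.con (⟨c.1, c.2.resolve_left h⟩ : C₂)).term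

/-- A term over the signature of the parallel sum is a term of one of the summands, once each
variable is assigned to a variable of one of the summands. -/
noncomputable def splitTerm [L.IsRelational] (τ : Fin n → Fin p ⊕ Fin q) :
    L[[↥(C₁ ∪ C₂)]].Term (Empty ⊕ Fin n) → SplitTerm L C₁ C₂ p q
  | .var (Sum.inl e) => e.elim
  | .var (Sum.inr i) => Sum.map (fun j => .var (Sum.inr j)) (fun j => .var (Sum.inr j)) (τ i)
  | .func (l := _) (Sum.inl f) _ => isEmptyElim f
  | .func (l := 0) (Sum.inr c) _ => splitConst c
  | .func (l := _ + 1) (Sum.inr f) _ => isEmptyElim f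

/-- The disjoint-union valuation of the variables. -/
def splitVal {A : Type y} {B : Type z} [L[[C₁]].Structure A] [L[[C₂]].Structure B]
    (τ : Fin n → Fin p ⊕ Fin q) (a : Fin p → A) (b : Fin q → B) (i : Fin n) :
    ParallelSum L C₁ C₂ A B :=
  Quot.mk _ (Sum.map a b (τ i))

theorem mk_realize_splitConst {A : Type y} {B : Type z} [L[[C₁]].Structure A]
    [L[[C₂]].Structure B] (a : Fin p → A) (b : Fin q → B) (c : ↥(C₁ ∪ C₂)) :
    (Quot.mk _ ((splitConst (L := L) c).realize a b) : ParallelSum L C₁ C₂ A B) =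
      const L C₁ C₂ A B c := by
  by_cases h : c.1 ∈ C₁
  · simp only [splitConst, SplitTerm.realize, const, h, dif_pos, Sum.map_inl,
      Term.realize_constants]
    rfl
  · simp only [splitConst, SplitTerm.realize, const, h, dif_neg, Sum.map_inr,
      Term.realize_constants, not_false_eq_true]
    rfl

theorem mk_realize_splitTerm [L.IsRelational] {A : Type y} {B : Type z} [L[[C₁]].Structure A]
    [L[[C₂]].Structure B] (τ : Fin n → Fin p ⊕ Fin q) (a : Fin p → A) (b : Fin q → B)
    (s : L[[↥(C₁ ∪ C₂)]].Term (Empty ⊕ Fin n)) :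
    (Quot.mk _ ((splitTerm τ s).realize a b) : ParallelSum L C₁ C₂ A B) =
      s.realize (Sum.elim default (splitVal τ a b)) := by
  match s with
  | .var (Sum.inl e) => exact e.elim
  | .var (Sum.inr i) =>
    simp only [splitTerm, SplitTerm.realize, Term.realize_var, Sum.elim_inr, splitVal]
    rcases τ i with j | j <;> rfl
  | .func (l := _) (Sum.inl f) _ => exact isEmptyElim f
  | .func (l := 0) (Sum.inr c) _ =>
    exact mk_realize_splitConst a b c
  | .func (l := _ + 1) (Sum.inr f) _ => exact isEmptyElim f

/-- The separated formula stating that the value of a split term is the shared constant `c`. -/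
def sharedFormula (c : ↥(C₁ ∩ C₂)) :
    SplitTerm L C₁ C₂ p q → SeparatedFormula L[[C₁]] L[[C₂]] p q
  | Sum.inl s => .both (.equal s (L.con (⟨c.1, c.2.1⟩ : C₁)).term) ⊤
  | Sum.inr s => .both ⊤ (.equal s (L.con (⟨c.1, c.2.2⟩ : C₂)).term)

/-- The separated formula stating that two split terms are equal in the disjoint union. -/
def eqFormula : SplitTerm L C₁ C₂ p q → SplitTerm L C₁ C₂ p q →
    SeparatedFormula L[[C₁]] L[[C₂]] p q
  | Sum.inl s, Sum.inl s' => .both (.equal s s') ⊤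
  | Sum.inr s, Sum.inr s' => .both ⊤ (.equal s s')
  | _, _ => .both ⊥ ⊤

/-- The separated formula stating that two split terms are equal in the parallel sum, where `E` is
the set of pairs of identified shared constants. -/
noncomputable def glueFormula (E : Finset (↥(C₁ ∩ C₂) × ↥(C₁ ∩ C₂)))
    (s s' : SplitTerm L C₁ C₂ p q) : SeparatedFormula L[[C₁]] L[[C₂]] p q :=
  (eqFormula s s').or (.iSup E fun e => (sharedFormula e.1 s).and (sharedFormula e.2 s'))

open Classical in
/-- The terms of the left summand that may occur in a tuple whose image is `s`. -/
noncomputable def leftTerms (E : Finset (↥(C₁ ∩ C₂) × ↥(C₁ ∩ C₂)))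
    (s : SplitTerm L C₁ C₂ p q) : Finset (L[[C₁]].Term (Empty ⊕ Fin p)) :=
  E.image (fun e => (L.con (⟨e.1.1, e.1.2.1⟩ : C₁)).term) ∪ Sum.elim singleton (fun _ => ∅) s

open Classical in
/-- The terms of the right summand that may occur in a tuple whose image is `s`. -/
noncomputable def rightTerms (E : Finset (↥(C₁ ∩ C₂) × ↥(C₁ ∩ C₂)))
    (s : SplitTerm L C₁ C₂ p q) : Finset (L[[C₂]].Term (Empty ⊕ Fin q)) :=
  E.image (fun e => (L.con (⟨e.1.1, e.1.2.2⟩ : C₂)).term) ∪ Sum.elim (fun _ => ∅) singleton s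

/-- The separated formula for a relation of the parallel sum. -/
noncomputable def relFormula (E : Finset (↥(C₁ ∩ C₂) × ↥(C₁ ∩ C₂))) {m : ℕ} (R : L.Relations m)
    (s : Fin m → SplitTerm L C₁ C₂ p q) : SeparatedFormula L[[C₁]] L[[C₂]] p q :=
  .or
    (.iSup (Fintype.piFinset fun i => leftTerms E (s i)) fun r =>
      .and (.both (.rel ((L.lhomWithConstants C₁).onRelation R) r) ⊤)
        (.iInf Finset.univ fun i => glueFormula E (s i) (Sum.inl (r i))))
    (.iSup (Fintype.piFinset fun i => rightTerms E (s i)) fun r =>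
      .and (.both ⊤ (.rel ((L.lhomWithConstants C₂).onRelation R) r))
        (.iInf Finset.univ fun i => glueFormula E (s i) (Sum.inr (r i))))

/-- The extension of an assignment of variables by a new variable of the left summand. -/
def snocLeft (τ : Fin n → Fin p ⊕ Fin q) : Fin (n + 1) → Fin (p + 1) ⊕ Fin q :=
  Fin.snoc (α := fun _ => Fin (p + 1) ⊕ Fin q) (fun i => Sum.map Fin.castSucc id (τ i))
    (Sum.inl (Fin.last p))

/-- The extension of an assignment of variables by a new variable of the right summand. -/
def snocRight (τ : Fin n → Fin p ⊕ Fin q) : Fin (n + 1) → Fin p ⊕ Fin (q + 1) :=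
  Fin.snoc (α := fun _ => Fin p ⊕ Fin (q + 1)) (fun i => Sum.map id Fin.castSucc (τ i))
    (Sum.inr (Fin.last q))

/-- The translation of a formula about the parallel sum into a separated formula about the two
summands, where `E` is the set of pairs of identified shared constants. -/
noncomputable def separate [L.IsRelational] (E : Finset (↥(C₁ ∩ C₂) × ↥(C₁ ∩ C₂))) :
    {n : ℕ} → L[[↥(C₁ ∪ C₂)]].BoundedFormula Empty n → {p q : ℕ} → (Fin n → Fin p ⊕ Fin q) →
      SeparatedFormula L[[C₁]] L[[C₂]] p q
  | _, .falsum, _, _, _ => .both ⊥ ⊤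
  | _, .equal s s', _, _, τ => glueFormula E (splitTerm τ s) (splitTerm τ s')
  | _, .rel (Sum.inl R) s, _, _, τ => relFormula E R fun i => splitTerm τ (s i)
  | _, .rel (Sum.inr R) _, _, _, _ => isEmptyElim R
  | _, .imp φ ψ, _, _, τ => (separate E φ τ).not.or (separate E ψ τ)
  | _, .all φ, _, _, τ =>
    ((separate E φ (snocLeft τ)).not.exLeft.or (separate E φ (snocRight τ)).not.exRight).not

theorem rankLE_sharedFormula {k : ℕ} (c : ↥(C₁ ∩ C₂)) (s : SplitTerm L C₁ C₂ p q) :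
    (sharedFormula c s).RankLE k := by
  rcases s with s | s <;>
  exact SeparatedFormula.rankLE_both (by simp [quantifierRank]) (by simp [quantifierRank])

theorem rankLE_false {k : ℕ} :
    (SeparatedFormula.both ⊥ ⊤ : SeparatedFormula L[[C₁]] L[[C₂]] p q).RankLE k :=
  SeparatedFormula.rankLE_both (Nat.zero_le k) (by simp [quantifierRank_top])

theorem rankLE_glueFormula {k : ℕ} (E : Finset (↥(C₁ ∩ C₂) × ↥(C₁ ∩ C₂)))
    (s s' : SplitTerm L C₁ C₂ p q) : (glueFormula E s s').RankLE k := by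
  refine SeparatedFormula.RankLE.or ?_ (SeparatedFormula.rankLE_iSup fun e _ =>
    (rankLE_sharedFormula _ _).and (rankLE_sharedFormula _ _))
  rcases s with s | s <;> rcases s' with s' | s'
  · exact SeparatedFormula.rankLE_both (Nat.zero_le k) (by simp [quantifierRank_top])
  · exact rankLE_false
  · exact rankLE_false
  · exact SeparatedFormula.rankLE_both (by simp [quantifierRank_top]) (Nat.zero_le k)

theorem rankLE_relFormula {k : ℕ} (E : Finset (↥(C₁ ∩ C₂) × ↥(C₁ ∩ C₂))) {m : ℕ}
    (R : L.Relations m) (s : Fin m → SplitTerm L C₁ C₂ p q) : (relFormula E R s).RankLE k := by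
  refine SeparatedFormula.RankLE.or ?_ ?_ <;>
  refine SeparatedFormula.rankLE_iSup fun r _ => SeparatedFormula.RankLE.and
    (SeparatedFormula.rankLE_both ?_ ?_)
    (SeparatedFormula.rankLE_iInf fun i _ => rankLE_glueFormula _ _ _) <;>
  simp [quantifierRank]

/-- Atomic formulas have rank 0 translations. In the `all` case each disjunct quantifies over one
summand only, so a quantifier costs at most one in each component. -/
theorem rankLE_separate [L.IsRelational] (E : Finset (↥(C₁ ∩ C₂) × ↥(C₁ ∩ C₂)))
    (φ : L[[↥(C₁ ∪ C₂)]].BoundedFormula Empty n) (τ : Fin n → Fin p ⊕ Fin q) :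
    (separate E φ τ).RankLE (quantifierRank φ) := by
  induction φ generalizing p q with
  | falsum => exact rankLE_false
  | equal s s' => exact rankLE_glueFormula _ _ _
  | rel R s =>
    rcases R with R | R
    · exact rankLE_relFormula _ _ _
    · exact isEmptyElim R
  | imp φ ψ ih₁ ih₂ =>
    exact ((ih₁ τ).mono (le_max_left _ _)).not.or ((ih₂ τ).mono (le_max_right _ _))
  | all φ ih => exact ((ih _).not.exLeft.or (ih _).not.exRight).not

end Translation

/-! ### Correctness of the translation. -/

section Correctness

variable {p q n : ℕ} {A : Type y} {B : Type z} [L[[C₁]].Structure A] [L[[C₂]].Structure B]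
  {E : Finset (↥(C₁ ∩ C₂) × ↥(C₁ ∩ C₂))} {a : Fin p → A} {b : Fin q → B}

theorem realize_sharedFormula {c : ↥(C₁ ∩ C₂)} {s : SplitTerm L C₁ C₂ p q} :
    (sharedFormula c s).Realize a b ↔ IsShared L A B c (s.realize a b) := by
  rcases s with s | s <;>
  simp only [sharedFormula, SeparatedFormula.realize_both, imp_self,
    BoundedFormula.Realize, Term.realize_constants, IsShared, SplitTerm.realize, Sum.map_inl,
    Sum.map_inr, leftConst, rightConst, constVal, Sum.inl.injEq, Sum.inr.injEq, reduceCtorEq,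
    and_true, true_and, or_false, false_or]

theorem realize_eqFormula {s s' : SplitTerm L C₁ C₂ p q} :
    (eqFormula s s').Realize a b ↔ s.realize a b = s'.realize a b := by
  rcases s with s | s <;> rcases s' with s' | s' <;>
  simp [eqFormula, SeparatedFormula.realize_both, SplitTerm.realize, BoundedFormula.Realize]

theorem realize_glueFormula
    (hE : ∀ c d : ↥(C₁ ∩ C₂), (c, d) ∈ E ↔ sharedConst L A B c = sharedConst L A B d)
    {s s' : SplitTerm L C₁ C₂ p q} :
    (glueFormula E s s').Realize a b ↔
      (Quot.mk _ (s.realize a b) : ParallelSum L C₁ C₂ A B) = Quot.mk _ (s'.realize a b) := by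
  rw [mk_eq_iff]
  simp only [glueFormula, SeparatedFormula.realize_or, SeparatedFormula.realize_iSup,
    SeparatedFormula.realize_and, realize_sharedFormula, realize_eqFormula, Prod.exists, hE]
  refine or_congr Iff.rfl (exists_congr fun c => exists_congr fun d => ?_)
  tauto

theorem exists_mem_leftTerms
    (hE : ∀ c d : ↥(C₁ ∩ C₂), (c, d) ∈ E ↔ sharedConst L A B c = sharedConst L A B d)
    {s : SplitTerm L C₁ C₂ p q} {x : A}
    (h : (Quot.mk _ (s.realize a b) : ParallelSum L C₁ C₂ A B) = inl L C₁ C₂ x) :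
    ∃ r ∈ leftTerms E s, r.realize (Sum.elim default a) = x := by
  classical
  rcases mk_eq_iff.1 h with h | ⟨-, c, -, hc | hc, -⟩
  · rcases s with s | s
    · exact ⟨s, by simp [leftTerms], Sum.inl.inj h⟩
    · cases h
  · refine ⟨(L.con (⟨c.1, c.2.1⟩ : C₁)).term, ?_, ?_⟩
    -- The diagonal pairs lie in `E`, so its first projection already yields every shared constant.
    · exact Finset.mem_union_left _ (Finset.mem_image.2 ⟨(c, c), (hE c c).2 rfl, rfl⟩)
    · rw [Term.realize_constants, Sum.inl.inj hc]
      rfl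
  · cases hc

theorem exists_mem_rightTerms
    (hE : ∀ c d : ↥(C₁ ∩ C₂), (c, d) ∈ E ↔ sharedConst L A B c = sharedConst L A B d)
    {s : SplitTerm L C₁ C₂ p q} {x : B}
    (h : (Quot.mk _ (s.realize a b) : ParallelSum L C₁ C₂ A B) = inr L C₁ C₂ x) :
    ∃ r ∈ rightTerms E s, r.realize (Sum.elim default b) = x := by
  classical
  rcases mk_eq_iff.1 h with h | ⟨-, c, -, hc | hc, -⟩
  · rcases s with s | s
    · cases h
    · exact ⟨s, by simp [rightTerms], Sum.inr.inj h⟩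
  · cases hc
  · refine ⟨(L.con (⟨c.1, c.2.2⟩ : C₂)).term, ?_, ?_⟩
    · exact Finset.mem_union_left _ (Finset.mem_image.2 ⟨(c, c), (hE c c).2 rfl, rfl⟩)
    · rw [Term.realize_constants, Sum.inr.inj hc]
      rfl

/-- Every preimage tuple is named by terms from finite sets, so a finite disjunction replaces the
existential quantifiers over tuples in the definition of the relation. -/
theorem realize_relFormula [L.IsRelational]
    (hE : ∀ c d : ↥(C₁ ∩ C₂), (c, d) ∈ E ↔ sharedConst L A B c = sharedConst L A B d)
    {m : ℕ} {R : L.Relations m}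
    {s : Fin m → SplitTerm L C₁ C₂ p q} :
    (relFormula E R s).Realize a b ↔
      (relStructure L C₁ C₂ A B).RelMap R fun i => Quot.mk _ ((s i).realize a b) := by
  simp only [relFormula, SeparatedFormula.realize_or, SeparatedFormula.realize_iSup,
    SeparatedFormula.realize_and, SeparatedFormula.realize_both, SeparatedFormula.realize_iInf,
    realize_glueFormula hE, imp_self, BoundedFormula.Realize,
    Fintype.mem_piFinset, Finset.mem_univ, true_imp_iff, and_true, true_and]
  refine or_congr ⟨?_, ?_⟩ ⟨?_, ?_⟩
  · rintro ⟨r, -, hr, hs⟩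
    exact ⟨_, hr, funext hs⟩
  · rintro ⟨x, hx, hs⟩
    choose r hr hrx using fun i => exists_mem_leftTerms hE (congrFun hs i)
    obtain rfl : (fun i => (r i).realize (Sum.elim default a)) = x := funext hrx
    exact ⟨r, hr, hx, congrFun hs⟩
  · rintro ⟨r, -, hr, hs⟩
    exact ⟨_, hr, funext hs⟩
  · rintro ⟨x, hx, hs⟩
    choose r hr hrx using fun i => exists_mem_rightTerms hE (congrFun hs i)
    obtain rfl : (fun i => (r i).realize (Sum.elim default b)) = x := funext hrx
    exact ⟨r, hr, hx, congrFun hs⟩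

theorem splitVal_snocLeft (τ : Fin n → Fin p ⊕ Fin q) (x : A) :
    (splitVal (snocLeft τ) (Fin.snoc a x : Fin (p + 1) → A) b :
      Fin (n + 1) → ParallelSum L C₁ C₂ A B) = Fin.snoc (splitVal τ a b) (inl L C₁ C₂ x) := by
  funext i
  refine Fin.lastCases ?_ (fun i => ?_) i
  · simp only [splitVal, snocLeft, Fin.snoc_last, Sum.map_inl]
    rfl
  · simp only [splitVal, snocLeft, Fin.snoc_castSucc]
    rcases τ i with j | j <;> simp <;> rfl

theorem splitVal_snocRight (τ : Fin n → Fin p ⊕ Fin q) (x : B) :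
    (splitVal (snocRight τ) a (Fin.snoc b x : Fin (q + 1) → B) :
      Fin (n + 1) → ParallelSum L C₁ C₂ A B) = Fin.snoc (splitVal τ a b) (inr L C₁ C₂ x) := by
  funext i
  refine Fin.lastCases ?_ (fun i => ?_) i
  · simp only [splitVal, snocRight, Fin.snoc_last, Sum.map_inr]
    rfl
  · simp only [splitVal, snocRight, Fin.snoc_castSucc]
    rcases τ i with j | j <;> simp <;> rfl

theorem realize_separate [L.IsRelational]
    (hE : ∀ c d : ↥(C₁ ∩ C₂), (c, d) ∈ E ↔ sharedConst L A B c = sharedConst L A B d)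
    (φ : L[[↥(C₁ ∪ C₂)]].BoundedFormula Empty n)
    (τ : Fin n → Fin p ⊕ Fin q) :
    (separate E φ τ).Realize a b ↔
      φ.Realize default (splitVal τ a b : Fin n → ParallelSum L C₁ C₂ A B) := by
  induction φ generalizing p q with
  | falsum => simp [separate, SeparatedFormula.realize_both, BoundedFormula.Realize]
  | equal s s' =>
    rw [separate, realize_glueFormula hE, mk_realize_splitTerm, mk_realize_splitTerm]
    rfl
  | rel R s =>
    rcases R with R | R
    · rw [separate, realize_relFormula hE]
      simp only [mk_realize_splitTerm]
      rfl
    · exact isEmptyElim R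
  | imp φ ψ ih₁ ih₂ =>
    rw [separate, SeparatedFormula.realize_or, SeparatedFormula.realize_not, ih₁, ih₂,
      BoundedFormula.realize_imp, imp_iff_not_or]
  | all φ ih =>
    simp only [separate, SeparatedFormula.realize_or, SeparatedFormula.realize_not,
      SeparatedFormula.realize_exLeft, SeparatedFormula.realize_exRight, ih, splitVal_snocLeft,
      splitVal_snocRight, BoundedFormula.realize_all, not_or, not_exists, not_not]
    constructor
    -- Every point of the quotient has a representative in one of the summands.
    · rintro ⟨h₁, h₂⟩ ⟨x | x⟩
      · exact h₁ x
      · exact h₂ x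
    · exact fun h => ⟨fun x => h _, fun x => h _⟩

end Correctness

end ParallelSum

/-! ### Transfer between the two sums. -/

theorem FOEquiv.constVal_eq_iff {L : FirstOrder.Language.{u, v}} {K : Type w} {C : Set K} {k : ℕ}
    {M : Type x} {N : Type y} [L[[C]].Structure M] [L[[C]].Structure N]
    (h : FOEquiv L[[C]] k M N) (c d : C) :
    constVal L M c = constVal L M d ↔ constVal L N c = constVal L N d := by
  have := h (.equal (L.con c).term (L.con d).term) (Nat.zero_le k)
  simp only [Sentence.Realize, Formula.Realize, BoundedFormula.Realize,
    Term.realize_constants] at this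
  exact this

theorem mainTheorem11 (L : FirstOrder.Language.{u, v}) [L.IsRelational] {K : Type w}
    (C₁ C₂ : Set K) (hC : (C₁ ∩ C₂).Finite) (k : ℕ)
    (A₁ : Type x) (B₁ : Type y) (A₂ : Type z) (B₂ : Type t)
    [L[[C₁]].Structure A₁] [L[[C₁]].Structure B₁]
    [L[[C₂]].Structure A₂] [L[[C₂]].Structure B₂]
    (h₁ : FOEquiv L[[C₁]] k A₁ B₁) (h₂ : FOEquiv L[[C₂]] k A₂ B₂) :
    FOEquiv L[[↥(C₁ ∪ C₂)]] k (ParallelSum L C₁ C₂ A₁ A₂) (ParallelSum L C₁ C₂ B₁ B₂) := by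
  classical
  intro φ hφ
  have := hC.fintype
  let E : Finset (↥(C₁ ∩ C₂) × ↥(C₁ ∩ C₂)) := Finset.univ.filter fun e =>
    ParallelSum.sharedConst L A₁ A₂ e.1 = ParallelSum.sharedConst L A₁ A₂ e.2
  have hA : ∀ c d : ↥(C₁ ∩ C₂), (c, d) ∈ E ↔
      ParallelSum.sharedConst L A₁ A₂ c = ParallelSum.sharedConst L A₁ A₂ d := by
    simp [E]
  have hB : ∀ c d : ↥(C₁ ∩ C₂), (c, d) ∈ E ↔
      ParallelSum.sharedConst L B₁ B₂ c = ParallelSum.sharedConst L B₁ B₂ d := by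
    intro c d
    rw [hA]
    exact ⟨ParallelSum.sharedConst_eq_of_imp (fun _ _ => (h₁.constVal_eq_iff _ _).1)
        fun _ _ => (h₂.constVal_eq_iff _ _).1,
      ParallelSum.sharedConst_eq_of_imp (fun _ _ => (h₁.constVal_eq_iff _ _).2)
        fun _ _ => (h₂.constVal_eq_iff _ _).2⟩
  let τ : Fin 0 → Fin 0 ⊕ Fin 0 := Fin.elim0
  have key : (ParallelSum.separate E φ τ).Realize (default : Fin 0 → A₁) (default : Fin 0 → A₂) ↔
      (ParallelSum.separate E φ τ).Realize (default : Fin 0 → B₁) (default : Fin 0 → B₂) := by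
    -- The same disjunct is satisfied on both sides, since each of its components is a sentence of
    -- rank at most `k`.
    refine exists_congr fun x => and_congr_right fun hx => ?_
    have hr := (ParallelSum.rankLE_separate E φ τ).mono hφ x hx
    exact and_congr (h₁ x.1 hr.1) (h₂ x.2 hr.2)
  rw [ParallelSum.realize_separate hA, ParallelSum.realize_separate hB] at key
  simpa only [Sentence.Realize, Formula.Realize, Subsingleton.elim _ default] using key
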